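/- For integers $t\ge 0$ and $0\le r\le m$ let $\mathrm{RM}(r,m)\subseteq\mathbb{F}_2^{2^m}$ be the binary Reed–Muller code of order $r$: $\mathrm{RM}(0,m)=\{\overline{0},\overline{1}\}$, $\mathrm{RM}(m,m)=\mathbb{F}_2^{2^m}$, and, for $1\le r\le m-1$, $\mathrm{RM}(r,m)=\{(\overline{u},\overline{u}+\overline{v}) : \overline{u}\in\mathrm{RM}(r,m-1),\ \overline{v}\in\mathrm{RM}(r-1,m-1)\}$. Let $R_t(r,m)$ be its $t$-th generalized covering radius, that is, the least integer $\rho\ge 0$ such that for every $\overline{v}_1,\dots,\overline{v}_t\in\mathbb{F}_2^{2^m}$ there are $\overline{c}_1,\dots,\overline{c}_t\in\mathrm{RM}(r,m)$ with $\left|\bigcup_{i=1}^t\operatorname{supp}(\overline{v}_i-\overline{c}_i)\right|\le\rho$. **Theorem.** For all integers $s\ge 3$ and $t\ge 0$, \[ \frac{t}{(s-1)!}\,m^{s-2}+O\!\left(m^{s-3}\log m\right)\ \le\ R_t(m-s,m)\ \le\ \frac{t}{(s-2)!}\,m^{s-2}+O\!\left(m^{s-3}\right)\qquad (m\ge s),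 \] where $s$ and $t$ are considered constants. Explicitly, there is a constant $C>0$, depending only on $s$ and $t$, such that for every integer $m\ge s$, \[ \frac{t}{(s-1)!}\,m^{s-2}-C\,m^{s-3}\log m\ \le\ R_t(m-s,m)\ \le\ \frac{t}{(s-2)!}\,m^{s-2}+C\,m^{s-3}. \] -/

import Mathlib

namespace GenCovRad

section Radius

variable {F ι : Type*} [Field F] [Fintype ι] {t : ℕ}

/-- The `t`-weight of a `t × n` matrix: the size of the union of the supports of its rows. -/
noncomputable def tWeight (v : Matrix (Fin t) ι F) : ℕ :=
  (⋃ i : Fin t, Function.support (v i)).ncard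

/-- The distance on `t × n` matrices induced by the `t`-weight. -/
noncomputable def tDist (v w : Matrix (Fin t) ι F) : ℕ := tWeight (v - w)

/-- The ball of radius `r` centred at `v` with respect to `tDist`. -/
def tBall (v : Matrix (Fin t) ι F) (r : ℕ) : Set (Matrix (Fin t) ι F) :=
  {w | tDist v w ≤ r}

/-- The set `C^t` of `t × n` matrices all of whose rows are codewords of `C`. -/
def tPower (C : Submodule F (ι → F)) (t : ℕ) : Set (Matrix (Fin t) ι F) :=
  {c | ∀ i, c i ∈ C}

/-- The `t`-th generalized covering radius of the linear code `C`: the least `r` such that the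
balls of radius `r` centred at the elements of `C^t` cover the space of all `t × n` matrices. -/
noncomputable def genCoveringRadius (t : ℕ) (C : Submodule F (ι → F)) : ℕ :=
  sInf {r : ℕ | ⋃ c ∈ tPower C t, tBall c r = Set.univ}

/-- The whole space is covered by balls of radius the length of the code, so the infimum in
`genCoveringRadius` is over a non-empty set. -/
theorem genCoveringRadius_nonempty (t : ℕ) (C : Submodule F (ι → F)) :
    {r : ℕ | ⋃ c ∈ tPower C t, tBall c r = Set.univ}.Nonempty := by
  refine ⟨Fintype.card ι, Set.eq_univ_of_forall fun w => ?_⟩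
  refine Set.mem_biUnion (x := (0 : Matrix (Fin t) ι F)) (fun i => C.zero_mem) ?_
  change Set.ncard _ ≤ Fintype.card ι
  rw [← Nat.card_eq_fintype_card]
  exact Set.ncard_le_card _

end Radius

/-- The space of binary vectors of length `2 ^ m`; the coordinates are labelled by the `2 ^ m`
binary strings of length `m`. The left half consists of the coordinates `(0, y)`, the right half of
the coordinates `(1, y)`. -/
abbrev Word (m : ℕ) : Type := (Fin m → ZMod 2) → ZMod 2

/-- The repetition code, consisting of the two constant vectors. -/
def repetitionCode (m : ℕ) : Submodule (ZMod 2) (Word m) where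
  carrier := {c | c = (fun _ => 0) ∨ c = (fun _ => 1)}
  zero_mem' := Or.inl rfl
  add_mem' := by
    rintro _ _ (rfl | rfl) (rfl | rfl)
    · left; funext _; rfl
    · right; funext _; rfl
    · right; funext _; rfl
    · left; funext _; rfl
  smul_mem' := by
    rintro a _ (rfl | rfl)
    · left; funext _; exact mul_zero a
    · fin_cases a
      · left; funext _; rfl
      · right; funext _; rfl

/-- The `(u, u + v)` construction: all vectors with left half `u` and right half `u + v`, where `u`
is in `C₁` and `v` is in `C₂`. -/
def uuvCode {m : ℕ} (C₁ C₂ : Submodule (ZMod 2) (Word m)) :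
    Submodule (ZMod 2) (Word (m + 1)) where
  carrier := {c | ∃ u ∈ C₁, ∃ v ∈ C₂, ∀ y : Fin m → ZMod 2,
    c (Fin.cons 0 y) = u y ∧ c (Fin.cons 1 y) = u y + v y}
  zero_mem' := ⟨0, C₁.zero_mem, 0, C₂.zero_mem, fun _ => by simp⟩
  add_mem' := by
    rintro c d ⟨u, hu, v, hv, h⟩ ⟨u', hu', v', hv', h'⟩
    refine ⟨u + u', C₁.add_mem hu hu', v + v', C₂.add_mem hv hv', fun y => ⟨?_, ?_⟩⟩
    · simp [(h y).1, (h' y).1]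
    · simp only [Pi.add_apply, (h y).2, (h' y).2]; ring
  smul_mem' := by
    rintro a c ⟨u, hu, v, hv, h⟩
    refine ⟨a • u, C₁.smul_mem a hu, a • v, C₂.smul_mem a hv, fun y => ⟨?_, ?_⟩⟩
    · simp [(h y).1]
    · simp only [Pi.smul_apply, (h y).2, smul_add]

/-- The `r`-th order Reed-Muller code of length `2 ^ m`, for `0 ≤ r ≤ m` (and, by convention, the
whole space for `r > m`): the repetition code for `r = 0`, the whole space for `r = m`, and
otherwise the `(u, u + v)` construction applied to `RM(r, m - 1)` and `RM(r - 1, m - 1)`. -/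
def reedMuller : (r m : ℕ) → Submodule (ZMod 2) (Word m)
  | 0, m => repetitionCode m
  | _ + 1, 0 => ⊤
  | r + 1, m + 1 =>
    if r + 1 < m + 1 then uuvCode (reedMuller (r + 1) m) (reedMuller r m) else ⊤

end GenCovRad

/-! Lower bound: by sphere covering, `t` times the redundancy of the code is at most `R * (m + t)`,
since each of `R` columns costs `m` bits for its position and `t` for its content. The redundancy of
RM(m-s, m) is at least `m.choose (s - 1)`; dividing by `m + t` gives the bound.

Upper bound: treating the rows separately costs a factor `t`, so ordinary covering suffices. For s =
3, a word lies in RM(m-3, m) once its sums against all monomials of degree at most 2 vanish. Those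
of degrees 1 and 2 form a symmetric matrix over `ZMod 2`, which is a sum of at most `m + 1` squares;
each square is a point to flip, and the origin repairs the parity. For larger s, covering bounds add
under (u, u + v), and Pascal's rule yields `m.choose (s - 2)` plus lower order
(`exists_covers_reedMuller`). -/

namespace GenCovRad

/-! ### Covering by balls and the sphere-covering bound -/

section Covering

variable {F ι : Type*} [Field F] {t : ℕ}

/-- Every word is within Hamming distance `ρ` of a codeword of `C`. -/
def Covers (C : Submodule F (ι → F)) (ρ : ℕ) : Prop :=
  ∀ v : ι → F, ∃ c ∈ C, (Function.support (v - c)).ncard ≤ ρ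

theorem Covers.mono {C : Submodule F (ι → F)} {ρ σ : ℕ} (h : Covers C ρ) (hρ : ρ ≤ σ) :
    Covers C σ := fun v => by
  obtain ⟨c, hc, hle⟩ := h v
  exact ⟨c, hc, hle.trans hρ⟩

theorem covers_card [Fintype ι] (C : Submodule F (ι → F)) : Covers C (Fintype.card ι) := fun v =>
  ⟨0, C.zero_mem, by
    rw [← Nat.card_eq_fintype_card]
    exact Set.ncard_le_card _⟩

theorem iUnion_tBall_eq_univ_iff (C : Submodule F (ι → F)) (r : ℕ) :
    ⋃ c ∈ tPower C t, tBall c r = Set.univ ↔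
      ∀ w : Matrix (Fin t) ι F, ∃ c ∈ tPower C t, tWeight (c - w) ≤ r := by
  simp [Set.eq_univ_iff_forall, tBall, tDist]

theorem exists_tWeight_sub_le [Fintype ι] (C : Submodule F (ι → F)) (w : Matrix (Fin t) ι F) :
    ∃ c ∈ tPower C t, tWeight (c - w) ≤ genCoveringRadius t C :=
  (iUnion_tBall_eq_univ_iff C _).1 (Nat.sInf_mem (genCoveringRadius_nonempty t C)) w

theorem tWeight_le_mul (v : Matrix (Fin t) ι F) (ρ : ℕ)
    (h : ∀ i, (Function.support (v i)).ncard ≤ ρ) : tWeight v ≤ t * ρ := by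
  classical
  have key : tWeight v ≤ ∑ i : Fin t, (Function.support (v i)).ncard := by
    have := Set.ncard_iUnion_le_of_fintype (fun i : Fin t => Function.support (v i))
    exact this
  calc tWeight v ≤ ∑ i : Fin t, (Function.support (v i)).ncard := key
    _ ≤ ∑ _i : Fin t, ρ := Finset.sum_le_sum fun i _ => h i
    _ = t * ρ := by simp

theorem genCoveringRadius_le_mul [Fintype ι] {C : Submodule F (ι → F)} {ρ : ℕ} (h : Covers C ρ) (t : ℕ) :
    genCoveringRadius t C ≤ t * ρ := by
  refine Nat.sInf_le ((iUnion_tBall_eq_univ_iff C _).2 fun w => ?_)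
  choose c hc hle using h
  refine ⟨fun i => c (w i), fun i => hc _, tWeight_le_mul _ _ fun i => ?_⟩
  rw [← Function.support_neg]
  convert hle (w i) using 2
  congr 1
  exact neg_sub _ _

/-- A matrix of `t`-weight at most `r` is determined by `r` labelled columns. -/
theorem exists_columns_of_tWeight_le [Fintype ι] [Nonempty ι] (v : Matrix (Fin t) ι F) {r : ℕ}
    (h : tWeight v ≤ r) :
    ∃ g : Fin r → ι, ∀ j, (∀ k, g k ≠ j) → ∀ i, v i j = 0 := by
  classical
  set S : Set ι := ⋃ i : Fin t, Function.support (v i) with hS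
  have hcard : Fintype.card S ≤ Fintype.card (Fin r) := by
    rw [Fintype.card_fin, ← Nat.card_eq_fintype_card]
    exact h
  obtain ⟨e⟩ := Function.Embedding.nonempty_of_card_le hcard
  -- Unused labels may point anywhere: extra columns do no harm.
  refine ⟨Function.extend e (fun x => (x : ι)) fun _ => Classical.arbitrary ι, fun j hj i => ?_⟩
  by_contra hne
  have hjS : j ∈ S := Set.mem_iUnion.2 ⟨i, hne⟩
  exact hj (e ⟨j, hjS⟩) (by rw [e.injective.extend_apply])

/-- The sphere-covering bound. -/
theorem card_pow_le_card_pow_mul [Fintype ι] [Nonempty ι] [Finite F] (C : Submodule F (ι → F)) (t : ℕ) :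
    (Nat.card F ^ Fintype.card ι) ^ t ≤
      Nat.card C ^ t * (Fintype.card ι * Nat.card F ^ t) ^ genCoveringRadius t C := by
  classical
  have := Fintype.ofFinite F
  set r := genCoveringRadius t C
  -- A position may be listed twice; any choice works, because the lists used below give equal
  -- positions equal contents.
  let decode (p : Fin r → ι × (Fin t → F)) : Matrix (Fin t) ι F := fun i j =>
    if h : ∃ k, (p k).1 = j then (p h.choose).2 i else 0
  let φ (q : (Fin t → C) × (Fin r → ι × (Fin t → F))) : Matrix (Fin t) ι F :=
    (show Matrix (Fin t) ι F from fun i => (q.1 i : ι → F)) - decode q.2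
  have hφ : Function.Surjective φ := fun w => by
    obtain ⟨c, hc, hw⟩ := exists_tWeight_sub_le C w
    obtain ⟨g, hg⟩ := exists_columns_of_tWeight_le (c - w) hw
    set d : Matrix (Fin t) ι F := c - w
    refine ⟨(fun i => ⟨c i, hc i⟩, fun k => (g k, fun i => d i (g k))), ?_⟩
    have hd : decode (fun k => (g k, fun i => d i (g k))) = c - w := by
      ext i j
      change (if h : ∃ k, g k = j then d i (g h.choose) else 0) = d i j
      split_ifs with h
      · rw [h.choose_spec]
      · exact (hg j (not_exists.1 h) i).symm
    change c - decode _ = w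
    rw [hd, sub_sub_cancel]
  have hle := Nat.card_le_card_of_surjective φ hφ
  have hM : Nat.card (Matrix (Fin t) ι F) = (Nat.card F ^ Fintype.card ι) ^ t := by
    change Nat.card (Fin t → ι → F) = _
    simp
  rw [hM] at hle
  simpa [Nat.card_prod, Nat.card_fun] using hle

end Covering

/-! ### The (u, u + v) recursion: covering and cardinality -/

section Halves

theorem sum_cons {m : ℕ} {M : Type*} [AddCommMonoid M] (F : (Fin (m + 1) → ZMod 2) → M) :
    ∑ x, F x = (∑ y : Fin m → ZMod 2, F (Fin.cons 0 y)) + ∑ y, F (Fin.cons 1 y) := by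
  rw [← (Fin.consEquiv fun _ : Fin (m + 1) => ZMod 2).sum_comp, Fintype.sum_prod_type]
  exact Fin.sum_univ_two _

theorem forall_cons {m : ℕ} {P : (Fin (m + 1) → ZMod 2) → Prop} :
    (∀ x, P x) ↔ (∀ y : Fin m → ZMod 2, P (Fin.cons 0 y)) ∧ ∀ y, P (Fin.cons 1 y) := by
  rw [Fin.forall_fin_succ_pi]
  exact Fin.forall_fin_two (p := fun a => ∀ y : Fin m → ZMod 2, P (Fin.cons a y))

theorem ncard_support_cons {m : ℕ} (f : Word (m + 1)) :
    (Function.support f).ncard =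
      (Function.support fun y : Fin m → ZMod 2 => f (Fin.cons 0 y)).ncard +
        (Function.support fun y : Fin m → ZMod 2 => f (Fin.cons 1 y)).ncard := by
  classical
  have key (n : ℕ) (g : Word n) : (Function.support g).ncard = ∑ x, if g x ≠ 0 then 1 else 0 := by
    rw [Finset.sum_boole, ← Set.ncard_coe_finset]
    simp [Function.support]
  simp only [key, sum_cons]

/-- The word with left half `u` and right half `w`. -/
def glue {m : ℕ} (u w : Word m) : Word (m + 1) := fun x => if x 0 = 0 then u (Fin.tail x)
  else w (Fin.tail x)

@[simp] theorem glue_cons_zero {m : ℕ} (u w : Word m) (y : Fin m → ZMod 2) :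
    glue u w (Fin.cons 0 y) = u y := by simp [glue]

@[simp] theorem glue_cons_one {m : ℕ} (u w : Word m) (y : Fin m → ZMod 2) :
    glue u w (Fin.cons 1 y) = w y := by simp [glue]

theorem glue_mem_uuvCode {m : ℕ} {C₁ C₂ : Submodule (ZMod 2) (Word m)} {u v : Word m}
    (hu : u ∈ C₁) (hv : v ∈ C₂) : glue u (u + v) ∈ uuvCode C₁ C₂ :=
  ⟨u, hu, v, hv, fun y => by simp⟩

/-- Correct the left half by `u`, then the right half minus `u` by `v`; the errors lie on disjoint
halves. -/
theorem Covers.uuvCode {m a b : ℕ} {C₁ C₂ : Submodule (ZMod 2) (Word m)} (h₁ : Covers C₁ a)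
    (h₂ : Covers C₂ b) : Covers (uuvCode C₁ C₂) (a + b) := fun f => by
  obtain ⟨u, hu, hua⟩ := h₁ fun y => f (Fin.cons 0 y)
  obtain ⟨v, hv, hvb⟩ := h₂ ((fun y => f (Fin.cons 1 y)) - u)
  refine ⟨_, glue_mem_uuvCode hu hv, ?_⟩
  rw [ncard_support_cons]
  refine add_le_add (le_of_eq_of_le ?_ hua) (le_of_eq_of_le ?_ hvb)
  · congr 2
  · congr 2
    ext y
    simp [sub_sub]

theorem card_uuvCode_le {m : ℕ} (C₁ C₂ : Submodule (ZMod 2) (Word m)) :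
    Nat.card (uuvCode C₁ C₂) ≤ Nat.card C₁ * Nat.card C₂ := by
  rw [← Nat.card_prod]
  refine Nat.card_le_card_of_surjective
    (fun p : C₁ × C₂ => (⟨_, glue_mem_uuvCode p.1.2 p.2.2⟩ : uuvCode C₁ C₂)) ?_
  rintro ⟨c, u, hu, v, hv, h⟩
  refine ⟨(⟨u, hu⟩, ⟨v, hv⟩), Subtype.ext (funext (forall_cons.2 ⟨fun y => ?_, fun y => ?_⟩))⟩
  · simp [(h y).1]
  · simp [(h y).2]

theorem reedMuller_eq_top {r m : ℕ} (hm : 0 < m) (h : m ≤ r) : reedMuller r m = ⊤ := by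
  obtain ⟨m, rfl⟩ := Nat.exists_eq_succ_of_ne_zero hm.ne'
  obtain ⟨r, rfl⟩ := Nat.exists_eq_succ_of_ne_zero (by omega : r ≠ 0)
  rw [reedMuller, if_neg (by omega)]

theorem reedMuller_succ_succ {r m : ℕ} (h : r < m) :
    reedMuller (r + 1) (m + 1) = uuvCode (reedMuller (r + 1) m) (reedMuller r m) := by
  rw [reedMuller, if_pos (by omega)]

/-- Of the full redundancy, the sum of `m.choose i` over `i > r`, one term is enough; it obeys
Pascal's rule, matching the recursion. -/
theorem card_reedMuller_mul_le (r m : ℕ) :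
    Nat.card (reedMuller r m) * 2 ^ m.choose (r + 1) ≤ 2 ^ 2 ^ m := by
  have htop (r m : ℕ) (h : m ≤ r) :
      Nat.card (reedMuller r m) * 2 ^ m.choose (r + 1) ≤ 2 ^ 2 ^ m := by
    rw [Nat.choose_eq_zero_of_lt (by omega), pow_zero, mul_one]
    refine (Nat.card_le_card_of_injective _ Subtype.val_injective).trans_eq ?_
    simp
  induction m generalizing r with
  | zero => exact htop r 0 (Nat.zero_le _)
  | succ m ih =>
    rcases le_or_gt (m + 1) r with h | h
    · exact htop _ _ h
    rcases r with _ | r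
    · have hc : Nat.card (reedMuller 0 (m + 1)) ≤ 2 := by
        rw [reedMuller]
        refine (Nat.card_le_card_of_surjective
          (fun a : ZMod 2 => (⟨fun _ => a, by
            fin_cases a
            · exact Or.inl rfl
            · exact Or.inr rfl⟩ :
            repetitionCode (m + 1))) ?_).trans_eq (by simp)
        rintro ⟨c, rfl | rfl⟩
        · exact ⟨0, rfl⟩
        · exact ⟨1, rfl⟩
      calc _ ≤ 2 * 2 ^ (m + 1) := by
            rw [zero_add, Nat.choose_one_right]
            exact Nat.mul_le_mul_right _ hc
        _ = 2 ^ (m + 1 + 1) := by ring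
        _ ≤ _ := Nat.pow_le_pow_right two_pos Nat.lt_two_pow_self
    · rw [reedMuller_succ_succ (by omega), Nat.choose_succ_succ]
      calc _ ≤ Nat.card (reedMuller (r + 1) m) * Nat.card (reedMuller r m) *
              2 ^ (m.choose (r + 1) + m.choose (r + 1 + 1)) :=
            Nat.mul_le_mul_right _ (card_uuvCode_le _ _)
        _ = (Nat.card (reedMuller (r + 1) m) * 2 ^ m.choose (r + 1 + 1)) *
              (Nat.card (reedMuller r m) * 2 ^ m.choose (r + 1)) := by ring
        _ ≤ 2 ^ 2 ^ m * 2 ^ 2 ^ m := Nat.mul_le_mul (ih _) (ih _)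
        _ = 2 ^ 2 ^ (m + 1) := by ring

theorem mul_choose_le_genCoveringRadius_mul (t r m : ℕ) :
    t * m.choose (r + 1) ≤ genCoveringRadius t (reedMuller r m) * (m + t) := by
  have h₁ := card_pow_le_card_pow_mul (reedMuller r m) t
  have h₂ := Nat.pow_le_pow_left (card_reedMuller_mul_le r m) t
  have hι : Fintype.card (Fin m → ZMod 2) = 2 ^ m := by simp
  have hF : Nat.card (ZMod 2) = 2 := by simp
  rw [hι, hF, ← pow_add] at h₁
  have h₃ := h₂.trans h₁
  rw [mul_pow] at h₃
  have h₄ := Nat.le_of_mul_le_mul_left h₃ (pow_pos Nat.card_pos t)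
  rw [← pow_mul, ← pow_mul, Nat.pow_le_pow_iff_right (by norm_num)] at h₄
  linarith

end Halves

/-! ### Parity checks of Reed–Muller codes -/

section Moments

/-- The sum of `f` against the monomial with variables indexed by `I`. -/
def moment {m : ℕ} (f : Word m) (I : Finset (Fin m)) : ZMod 2 := ∑ x, f x * ∏ i ∈ I, x i

theorem moment_map_succ {m : ℕ} (f : Word (m + 1)) (I : Finset (Fin m)) :
    moment f (I.map (Fin.succEmb m)) =
      moment (fun y => f (Fin.cons 0 y)) I + moment (fun y => f (Fin.cons 1 y)) I := by
  simp [moment, sum_cons, Finset.prod_map]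

theorem moment_insert_zero {m : ℕ} (f : Word (m + 1)) (I : Finset (Fin m)) :
    moment f (insert 0 (I.map (Fin.succEmb m))) = moment (fun y => f (Fin.cons 1 y)) I := by
  have h0 : (0 : Fin (m + 1)) ∉ I.map (Fin.succEmb m) := by simp [Fin.succ_ne_zero]
  simp [moment, sum_cons, Finset.prod_insert h0, Finset.prod_map]

theorem moment_sub {m : ℕ} (f g : Word m) (I : Finset (Fin m)) :
    moment (f - g) I = moment f I - moment g I := by
  simp [moment, sub_mul, Finset.sum_sub_distrib]

/-- A monomial containing the first variable sees only the right half, at the cost of one degree;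
one without it sees the sum of the halves. -/
theorem halves_moments {m s : ℕ} {f : Word (m + 1)} (h : ∀ I, I.card ≤ s → moment f I = 0) :
    (∀ I, I.card + 1 ≤ s → moment (fun y => f (Fin.cons 0 y)) I = 0) ∧
      ∀ I, I.card ≤ s →
        moment ((fun y => f (Fin.cons 1 y)) - fun y => f (Fin.cons 0 y)) I = 0 := by
  have h0 (I : Finset (Fin m)) : (0 : Fin (m + 1)) ∉ I.map (Fin.succEmb m) := by
    simp [Fin.succ_ne_zero]
  have hsum (I : Finset (Fin m)) (hI : I.card ≤ s) :=
    (moment_map_succ f I).symm.trans (h _ (by rwa [Finset.card_map]))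
  refine ⟨fun I hI => ?_, fun I hI => ?_⟩
  · have h1 := (moment_insert_zero f I).symm.trans
      (h _ (by rwa [Finset.card_insert_of_notMem (h0 I), Finset.card_map]))
    simpa [h1] using hsum I (by omega)
  · rw [moment_sub, CharTwo.sub_eq_add, add_comm]
    exact hsum I hI

theorem eq_zero_of_moments {m : ℕ} (f : Word m) (h : ∀ I, moment f I = 0) : f = 0 := by
  induction m with
  | zero =>
    funext x
    have h' := h ∅
    rw [moment, Fintype.sum_subsingleton _ x] at h'
    simpa using h'
  | succ m ih =>
    obtain ⟨h0, h1⟩ := halves_moments (s := m + 1) fun I _ => h I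
    have hle (I : Finset (Fin m)) : I.card ≤ m := card_finset_fin_le I
    have e0 := ih _ fun I => h0 I (Nat.succ_le_succ (hle I))
    have e1 := ih _ fun I => h1 I ((hle I).trans m.le_succ)
    rw [e0, sub_zero] at e1
    exact funext (forall_cons.2 ⟨congrFun e0, congrFun e1⟩)

theorem mem_repetitionCode_of_moments {m : ℕ} (f : Word m) (h : ∀ I, I.card < m → moment f I = 0) :
    f ∈ repetitionCode m := by
  suffices ∃ a, f = fun _ => a by
    obtain ⟨a, rfl⟩ := this
    fin_cases a
    · exact Or.inl rfl
    · exact Or.inr rfl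
  induction m with
  | zero => exact ⟨f default, funext fun x => by rw [Subsingleton.elim x default]⟩
  | succ m ih =>
    obtain ⟨h0, h1⟩ := halves_moments (s := m) fun I hI => h I (Nat.lt_succ_of_le hI)
    obtain ⟨a, ha⟩ := ih _ h0
    have e1 := eq_zero_of_moments _ fun I => h1 I (card_finset_fin_le I)
    refine ⟨a, funext (forall_cons.2 ⟨congrFun ha, fun y => ?_⟩)⟩
    have := congrFun e1 y
    have h2 := congrFun ha y
    simp only [Pi.sub_apply, Pi.zero_apply, sub_eq_zero] at this
    exact this.trans h2

/-- The half of the duality between RM(r, m) and RM(m-r-1, m) that certifies codewords. -/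
theorem mem_reedMuller_of_moments {m r : ℕ} (hr : r ≤ m) (f : Word m)
    (h : ∀ I, I.card + r < m → moment f I = 0) : f ∈ reedMuller r m := by
  induction m generalizing r with
  | zero =>
    obtain rfl : r = 0 := by omega
    rw [reedMuller]
    exact mem_repetitionCode_of_moments f fun I hI => h I hI
  | succ m ih =>
    rcases r with _ | r
    · rw [reedMuller]
      exact mem_repetitionCode_of_moments f fun I hI => h I hI
    rcases (Nat.succ_le_succ_iff.1 hr).eq_or_lt with rfl | hr
    · rw [reedMuller_eq_top (by omega) le_rfl]
      trivial
    obtain ⟨h0, h1⟩ := halves_moments (s := m - r - 1) fun I hI => h I (by omega)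
    rw [reedMuller_succ_succ hr]
    refine ⟨_, ih (by omega) _ fun I hI => h0 I (by omega), _,
      ih hr.le _ fun I hI => h1 I (by omega), fun y => ⟨rfl, ?_⟩⟩
    simp

end Moments

/-! ### Symmetric forms over `ZMod 2` as sums of squares -/

section Squares

variable {V : Type*} [AddCommGroup V] [Module (ZMod 2) V] [FiniteDimensional (ZMod 2) V]

/-- A symmetric bilinear form over `ZMod 2` that is not alternating is a sum of at most
`rank B` squares of linear forms. -/
theorem exists_sum_squares_of_ne_zero (n : ℕ) (B : V →ₗ[ZMod 2] V →ₗ[ZMod 2] ZMod 2)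
    (hB : ∀ x y, B x y = B y x) (v : V) (hv : B v v ≠ 0)
    (hn : Module.finrank (ZMod 2) V ≤ Module.finrank (ZMod 2) (LinearMap.ker B) + n) :
    ∃ g : Fin n → V →ₗ[ZMod 2] ZMod 2, ∀ x y, B x y = ∑ i, g i x * g i y := by
  have h01 (a : ZMod 2) (ha : a ≠ 0) : a = 1 := by
    revert a
    decide
  induction n generalizing B v with
  | zero =>
    have htop : LinearMap.ker B = ⊤ := Submodule.eq_top_of_finrank_eq
      (le_antisymm (Submodule.finrank_le _) (by simpa using hn))
    rw [LinearMap.ker_eq_top] at htop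
    simp [htop] at hv
  | succ n ih =>
    -- Splitting off `w` with `B w w = 1` lowers the rank.
    let B' (w : V) : V →ₗ[ZMod 2] V →ₗ[ZMod 2] ZMod 2 := B - (B w).smulRight (B w)
    have hB' (w x y : V) : B' w x y = B x y - B w x * B w y := by simp [B']
    have hker (w : V) (hw : B w w = 1) :
        LinearMap.ker B < LinearMap.ker (B' w) := by
      refine lt_of_le_of_ne (fun u hu => ?_) fun h => ?_
      · rw [LinearMap.mem_ker] at hu ⊢
        ext y
        rw [hB', hB w u, hu]
        simp
      · have hmem : w ∈ LinearMap.ker (B' w) := by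
          rw [LinearMap.mem_ker]
          ext y
          rw [hB', hw]
          simp
        rw [← h, LinearMap.mem_ker] at hmem
        simp [hmem] at hw
    have step (w : V) (hw : B w w = 1)
        (h : ∃ g : Fin n → V →ₗ[ZMod 2] ZMod 2, ∀ x y, B' w x y = ∑ i, g i x * g i y) :
        ∃ g : Fin (n + 1) → V →ₗ[ZMod 2] ZMod 2, ∀ x y, B x y = ∑ i, g i x * g i y := by
      obtain ⟨g, hg⟩ := h
      refine ⟨Fin.cons (B w) g, fun x y => ?_⟩
      simp only [Fin.sum_univ_succ, Fin.cons_zero, Fin.cons_succ, ← hg, hB']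
      ring
    have good (w : V) (hw : B w w = 1) (u : V) (hu : B' w u u ≠ 0) :
        ∃ g : Fin (n + 1) → V →ₗ[ZMod 2] ZMod 2, ∀ x y, B x y = ∑ i, g i x * g i y := by
      refine step w hw (ih (B' w) (fun x y => ?_) u hu ?_)
      · rw [hB', hB', hB x y]
        ring
      · have := Submodule.finrank_lt_finrank_of_lt (hker w hw)
        omega
    have hv1 := h01 _ hv
    by_cases hne : ∃ u, B' v u u ≠ 0
    · obtain ⟨u, hu⟩ := hne
      exact good v hv1 u hu
    push Not at hne
    by_cases hz : B' v = 0
    · exact step v hv1 ⟨0, fun x y => by simp [hz]⟩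
    -- Otherwise `B' v` contains a hyperbolic plane, and `v` is moved along it.
    obtain ⟨a, b, hab⟩ : ∃ a b, B' v a b ≠ 0 := by
      by_contra! h
      exact hz (LinearMap.ext₂ h)
    have hab1 := h01 _ hab
    set a' := a - B v a • v with ha'
    set b' := b - B v b • v with hb'
    have hva : B v a' = 0 := by simp [ha', hv1]
    have hvb : B v b' = 0 := by simp [hb', hv1]
    have hav : B a' v = 0 := by rw [hB, hva]
    have hbv : B b' v = 0 := by rw [hB, hvb]
    have haa : B a' a' = 0 := by
      have := hne a'
      rwa [hB', hva, zero_mul, sub_zero] at this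
    have hbb : B b' b' = 0 := by
      have := hne b'
      rwa [hB', hvb, zero_mul, sub_zero] at this
    have hab' : B a' b' = 1 := by
      rw [← hab1, hB']
      simp [ha', hb', hv1, hB a v, mul_comm]
    -- Splitting off `v + a'` leaves the value 1 - (1 + 1)² = 1 at `v + b'`, so the remainder is not
    -- alternating.
    refine good (v + a') (by simp [hva, hav, haa, hv1]) (v + b') ?_
    rw [hB']
    simp [hvb, hbv, hbb, hv1, hav, hab', CharTwo.add_self_eq_zero]

/-- A nonzero alternating form stops being alternating after one square is subtracted, whence the `+
1`. -/
theorem exists_sum_squares (B : V →ₗ[ZMod 2] V →ₗ[ZMod 2] ZMod 2) (hB : ∀ x y, B x y = B y x) :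
    ∃ g : Fin (Module.finrank (ZMod 2) V + 1) → V →ₗ[ZMod 2] ZMod 2,
      ∀ x y, B x y = ∑ i, g i x * g i y := by
  by_cases h : ∃ v, B v v ≠ 0
  · obtain ⟨v, hv⟩ := h
    exact exists_sum_squares_of_ne_zero _ B hB v hv (by omega)
  push Not at h
  by_cases hz : B = 0
  · exact ⟨0, fun x y => by simp [hz]⟩
  obtain ⟨a, b, hab⟩ : ∃ a b, B a b ≠ 0 := by
    by_contra! h
    exact hz (LinearMap.ext₂ h)
  obtain ⟨g, hg⟩ := exists_sum_squares_of_ne_zero (Module.finrank (ZMod 2) V)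
    (B - (B a).smulRight (B a)) (fun x y => by simp [hB x y, mul_comm]) b
    (by simp [h b, hab]) (by omega)
  refine ⟨Fin.cons (B a) g, fun x y => ?_⟩
  simp only [Fin.sum_univ_succ, Fin.cons_zero, Fin.cons_succ, ← hg]
  simp

end Squares

/-! ### Covering bounds for Reed–Muller codes -/

section CoveringRadius

/-- The word of finitely many marked points, counted with multiplicity modulo `2`. -/
def pointWord {m k : ℕ} (p : Fin k → Fin m → ZMod 2) : Word m := fun x =>
  ∑ i, if x = p i then 1 else 0

theorem moment_pointWord {m k : ℕ} (p : Fin k → Fin m → ZMod 2) (I : Finset (Fin m)) :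
    moment (pointWord p) I = ∑ i, ∏ j ∈ I, p i j := by
  simp only [moment, pointWord, Finset.sum_mul]
  rw [Finset.sum_comm]
  simp

theorem ncard_support_pointWord_le {m k : ℕ} (p : Fin k → Fin m → ZMod 2) :
    (Function.support (pointWord p)).ncard ≤ k := by
  have hsub : Function.support (pointWord p) ⊆ Set.range p := fun x hx => by
    by_contra h
    refine hx (Finset.sum_eq_zero fun i _ => if_neg fun hi => h ⟨i, hi.symm⟩)
  refine (Set.ncard_le_ncard hsub (Set.toFinite _)).trans ?_
  rw [← Set.image_univ]
  exact (Set.ncard_image_le (Set.toFinite _)).trans (by simp [Set.ncard_univ])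

/-- The moments of degree one and two of `f` are those of at most `m + 1` points. -/
theorem exists_points_moment_eq {m : ℕ} (f : Word m) :
    ∃ p : Fin (m + 1) → Fin m → ZMod 2,
      ∀ j l, moment (pointWord p) {j, l} = moment f {j, l} := by
  let coord (x : Fin m → ZMod 2) : (Fin m → ZMod 2) →ₗ[ZMod 2] ZMod 2 :=
    Fintype.linearCombination (ZMod 2) x
  let B : (Fin m → ZMod 2) →ₗ[ZMod 2] (Fin m → ZMod 2) →ₗ[ZMod 2] ZMod 2 :=
    ∑ x, f x • (coord x).smulRight (coord x)
  have hB (a b : Fin m → ZMod 2) : B a b = ∑ x, f x * (coord x a * coord x b) := by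
    simp [B, LinearMap.sum_apply]
  have hcoord (x : Fin m → ZMod 2) (j : Fin m) : coord x (Pi.single j 1) = x j := by
    simp [coord]
  have hsum := exists_sum_squares B fun a b => by simp only [hB, mul_comm]
  rw [Module.finrank_fin_fun] at hsum
  obtain ⟨g, hg⟩ := hsum
  -- Since a = a², the diagonal of `B` records the degree-one moments.
  have hsq (a : ZMod 2) : a = a * a := by
    revert a
    decide
  have hpair (x : Fin m → ZMod 2) (j l : Fin m) : ∏ i ∈ {j, l}, x i = x j * x l := by
    rcases eq_or_ne j l with rfl | h
    · simp [← hsq]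
    · exact Finset.prod_pair h
  refine ⟨fun i j => g i (Pi.single j 1), fun j l => ?_⟩
  rw [moment_pointWord]
  simp only [hpair, moment]
  rw [← hg, hB]
  simp only [hcoord]

theorem covers_reedMuller_three {m : ℕ} (hm : 3 ≤ m) : Covers (reedMuller (m - 3) m) (m + 2) := by
  intro f
  obtain ⟨p, hp⟩ := exists_points_moment_eq f
  -- Flipping the origin changes only the moment of the empty monomial.
  set ε : ZMod 2 := moment (f - pointWord p) ∅ with hε
  let δ : Word m := fun x => if x = 0 then ε else 0
  have hδ (I : Finset (Fin m)) : moment δ I = if I = ∅ then ε else 0 := by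
    simp only [moment, δ, ite_mul, zero_mul, Finset.sum_ite_eq', Finset.mem_univ, if_true]
    rcases I.eq_empty_or_nonempty with rfl | ⟨i, hi⟩
    · simp
    · rw [if_neg (Finset.ne_empty_of_mem hi), Finset.prod_eq_zero hi rfl, mul_zero]
  refine ⟨f - pointWord p - δ, mem_reedMuller_of_moments (by omega) _ fun I hI => ?_, ?_⟩
  · rw [moment_sub, hδ]
    split_ifs with h
    · rw [h, ← hε, sub_self]
    · have hI2 : ∃ j l, I = {j, l} := by
        have h0 := Finset.card_pos.2 (Finset.nonempty_iff_ne_empty.2 h)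
        obtain h1 | h2 : I.card = 1 ∨ I.card = 2 := by omega
        · obtain ⟨j, rfl⟩ := Finset.card_eq_one.1 h1
          exact ⟨j, j, by simp⟩
        · obtain ⟨j, l, -, rfl⟩ := Finset.card_eq_two.1 h2
          exact ⟨j, l, rfl⟩
      obtain ⟨j, l, rfl⟩ := hI2
      rw [moment_sub, hp, sub_self, sub_zero]
  · have e : f - (f - pointWord p - δ) = pointWord p + δ := by abel
    rw [e]
    have hδs : Function.support δ ⊆ {0} := fun x hx => by
      by_contra h
      exact hx (if_neg h)
    calc _ ≤ (Function.support (pointWord p) ∪ Function.support δ).ncard :=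
          Set.ncard_le_ncard (Function.support_add _ _) (Set.toFinite _)
      _ ≤ _ := Set.ncard_union_le _ _
      _ ≤ (m + 1) + 1 := add_le_add (ncard_support_pointWord_le p)
          ((Set.ncard_le_ncard hδs (Set.toFinite _)).trans_eq (Set.ncard_singleton _))

theorem exists_covers_reedMuller (k : ℕ) : ∃ K : ℕ, ∀ m, k + 3 ≤ m →
    Covers (reedMuller (m - (k + 3)) m) (m.choose (k + 1) + K * m.choose k) := by
  induction k with
  | zero => exact ⟨2, fun m hm => by simpa using covers_reedMuller_three hm⟩
  | succ k ih =>
    obtain ⟨K, hK⟩ := ih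
    -- In the base case m = k + 4 the whole length 2 ^ (k + 4) is a trivial bound.
    refine ⟨max K (2 ^ (k + 4)), fun m hm => ?_⟩
    induction m, hm using Nat.le_induction with
    | base =>
      refine (covers_card _).mono ?_
      rw [Fintype.card_fun, ZMod.card, Fintype.card_fin]
      have h := Nat.choose_pos (show k + 1 ≤ k + 1 + 3 by omega)
      calc 2 ^ (k + 1 + 3) ≤ max K (2 ^ (k + 4)) := le_max_right _ _
        _ ≤ max K (2 ^ (k + 4)) * (k + 1 + 3).choose (k + 1) := Nat.le_mul_of_pos_right _ h
        _ ≤ _ := Nat.le_add_left _ _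
    | succ m hm ihm =>
      obtain ⟨r, rfl⟩ : ∃ r, m = r + (k + 1 + 3) := ⟨m - (k + 1 + 3), by omega⟩
      have h₁ := hK (r + (k + 1 + 3)) (by omega)
      rw [show r + (k + 1 + 3) - (k + 3) = r + 1 by omega] at h₁
      rw [Nat.add_sub_cancel] at ihm
      rw [show r + (k + 1 + 3) + 1 - (k + 1 + 3) = r + 1 by omega, reedMuller_succ_succ (by omega)]
      refine (h₁.uuvCode ihm).mono ?_
      rw [Nat.choose_succ_succ _ (k + 1), Nat.choose_succ_succ _ k, mul_add]
      have := Nat.mul_le_mul_right ((r + (k + 1 + 3)).choose k) (le_max_left K (2 ^ (k + 4)))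
      simp only [Nat.succ_eq_add_one] at *
      linarith

end CoveringRadius

/-! ### From binomials to powers of `m` -/

section Asymptotics

/-- Each factor of the falling factorial is at least `m - k`; Bernoulli's inequality does the rest.
-/
theorem pow_sub_le_factorial_mul_choose (m k : ℕ) (h : k ≤ m) :
    (m : ℝ) ^ (k + 1) - (k + 1) * k * (m : ℝ) ^ k ≤ (k + 1).factorial * m.choose (k + 1) := by
  have h₁ : ((m : ℝ) - k) ^ (k + 1) ≤ (k + 1).factorial * m.choose (k + 1) := by
    have := Nat.pow_sub_le_descFactorial m (k + 1)
    rw [Nat.descFactorial_eq_factorial_mul_choose, Nat.add_sub_add_right] at this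
    have h' : (((m - k) ^ (k + 1) : ℕ) : ℝ) ≤ ((k + 1).factorial * m.choose (k + 1) : ℕ) := by
      exact_mod_cast this
    push_cast [Nat.cast_sub h] at h'
    exact h'
  refine le_trans ?_ h₁
  rcases m.eq_zero_or_pos with rfl | hm
  · obtain rfl : k = 0 := by omega
    simp
  have hm' : (0 : ℝ) < m := by exact_mod_cast hm
  have hk : (k : ℝ) / m ≤ 1 := (div_le_one hm').2 (by exact_mod_cast h)
  have hb := one_add_mul_le_pow (a := -((k : ℝ) / m)) (by linarith) (k + 1)
  have := mul_le_mul_of_nonneg_left hb (pow_nonneg hm'.le (k + 1))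
  rw [← mul_pow] at this
  convert this using 1
  · push_cast
    field_simp
    ring
  · congr 1
    field_simp
    ring

end Asymptotics

end GenCovRad

theorem mainTheorem5 (s t : ℕ) (hs : 3 ≤ s) :
    ∃ C : ℝ, 0 < C ∧ ∀ m : ℕ, s ≤ m →
      (t : ℝ) / (Nat.factorial (s - 1) : ℝ) * (m : ℝ) ^ (s - 2)
          - C * ((m : ℝ) ^ (s - 3) * Real.log (m : ℝ))
        ≤ (GenCovRad.genCoveringRadius t (GenCovRad.reedMuller (m - s) m) : ℝ) ∧
      (GenCovRad.genCoveringRadius t (GenCovRad.reedMuller (m - s) m) : ℝ)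
        ≤ (t : ℝ) / (Nat.factorial (s - 2) : ℝ) * (m : ℝ) ^ (s - 2)
          + C * (m : ℝ) ^ (s - 3) := by
  obtain ⟨k, rfl⟩ := Nat.exists_eq_add_of_le' hs
  obtain ⟨K, hK⟩ := GenCovRad.exists_covers_reedMuller k
  simp only [show k + 3 - 1 = k + 2 by omega, show k + 3 - 2 = k + 1 by omega,
    Nat.add_sub_cancel]
  set A : ℝ := (k + 2) * (k + 1) with hA
  set c : ℝ := t / (k + 2).factorial with hc
  have hA0 : 0 ≤ A := by positivity
  have hc0 : 0 ≤ c := by positivity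
  -- `c * (A + t)` pays for the lower bound, `t * K` for the upper, and `1` ensures positivity.
  refine ⟨c * (A + t) + t * K + 1, by positivity, fun m hm => ?_⟩
  set R := GenCovRad.genCoveringRadius t (GenCovRad.reedMuller (m - (k + 3)) m) with hR
  have hm0 : (0 : ℝ) < m := by exact_mod_cast (by omega : 0 < m)
  constructor
  -- The logarithm is used only through `log m ≥ 1`; the argument gives an error of order `m ^ k`.
  · have hlog : 1 ≤ Real.log m := by
      rw [Real.le_log_iff_exp_le hm0]
      have : (3 : ℝ) ≤ m := by exact_mod_cast (by omega : 3 ≤ m)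
      exact Real.exp_one_lt_three.le.trans this
    have hlow : (t : ℝ) * m.choose (k + 2) ≤ R * (m + t) := by
      have := GenCovRad.mul_choose_le_genCoveringRadius_mul t (m - (k + 3)) m
      rw [show m - (k + 3) + 1 = m - (k + 2) by omega, Nat.choose_symm (by omega)] at this
      exact_mod_cast this
    have hch := GenCovRad.pow_sub_le_factorial_mul_choose m (k + 1) (by omega)
    have hkey : c * ((m : ℝ) ^ (k + 2) - A * (m : ℝ) ^ (k + 1)) ≤ R * (m + t) := by
      refine le_trans ?_ hlow
      have hfac : (0 : ℝ) < (k + 2).factorial := by exact_mod_cast Nat.factorial_pos _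
      calc _ ≤ c * ((k + 2).factorial * m.choose (k + 2)) := by
            refine mul_le_mul_of_nonneg_left (le_trans (le_of_eq ?_) hch) hc0
            rw [hA]
            push_cast
            ring
        _ = _ := by
            rw [hc]
            field_simp
    have hmain : c * (m : ℝ) ^ (k + 1) - c * (A + t) * (m : ℝ) ^ k ≤ R := by
      have hpos : (0 : ℝ) < m + t := by positivity
      refine le_of_mul_le_mul_right (le_trans ?_ hkey) hpos
      -- This is the cross term dropped after multiplying out by `m + t`.
      have : 0 ≤ c * (A + t) * t * (m : ℝ) ^ k := by positivity
      rw [pow_succ (m : ℝ) (k + 1), pow_succ (m : ℝ) k]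
      linarith
    refine le_trans (sub_le_sub_left ?_ _) hmain
    have hp : (0 : ℝ) ≤ (m : ℝ) ^ k := by positivity
    have h1 : (m : ℝ) ^ k ≤ (m : ℝ) ^ k * Real.log m := le_mul_of_one_le_right hp hlog
    refine mul_le_mul ?_ h1 hp (by positivity)
    have : (0 : ℝ) ≤ t * K := by positivity
    linarith
  · have hup : (R : ℝ) ≤ t * (m.choose (k + 1) + K * m.choose k) := by
      exact_mod_cast GenCovRad.genCoveringRadius_le_mul (hK m hm) t
    have h1 : (m.choose (k + 1) : ℝ) ≤ (m : ℝ) ^ (k + 1) / (k + 1).factorial :=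
      Nat.choose_le_pow_div _ _
    have h2 : (m.choose k : ℝ) ≤ (m : ℝ) ^ k := by exact_mod_cast Nat.choose_le_pow m k
    calc (R : ℝ) ≤ t * (m.choose (k + 1) + K * m.choose k) := hup
      _ ≤ t * ((m : ℝ) ^ (k + 1) / (k + 1).factorial + K * (m : ℝ) ^ k) := by gcongr
      _ = t / (k + 1).factorial * (m : ℝ) ^ (k + 1) + t * K * (m : ℝ) ^ k := by ring
      _ ≤ _ := by
        gcongr
        have : 0 ≤ c * (A + t) := by positivity
        linarith
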